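/- Let $\Phi$ be an irreducible (reduced, crystallographic, finite) root system spanning a real vector space $E$, with positive system $\Phi^+$, simple system $\Pi$, and highest root $\theta=\sum_{\alpha\in\Pi}m_\alpha\alpha$; for a root $\beta$ let $c_\alpha(\beta)$ denote the coefficient of $\alpha\in\Pi$ in $\beta$, extended linearly to $E$. Let $\mathcal P$ be the convex hull of $\Phi$. For $\emptyset\ne S\subseteq\Pi$ let $F_S=\{x\in\mathcal P : c_\alpha(x)=m_\alpha \text{ for all } \alpha\in S\}$ be the corresponding standard parabolic face and $I_{F_S}=F_S\cap\Phi$ the corresponding face ideal. For $A\subseteq\Pi$ put $A^\circ=\{\theta\}\cup(-A)$, and let $A^\circ_\theta$ be the connected component of $\theta$ in $A^\circ$, where two elements are joined when they are not orthogonal. Write $\Phi(X)$ for the root subsystem generated by $X\subseteq\Phi$, i.e. the smallest subset of $\Phi$ that contains $X$ and is stable under the reflections in its own elements. For a root subsystem $\Psi$ with simple system $\Delta$, the positive system relative to $\Delta$ is $\Psi^+=\Psi\cap\mathbb N\Delta$, ordered by $\beta\le\gamma$ iff $\gamma-\beta\in\mathbb N\Psi^+$. An abelian ideal of $\Psi^+$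 is an upward closed subset $I\subseteq\Psi^+$ such that no sum of two elements of $I$ lies in $\Psi$; the principal ideal generated by $\beta\in\Psi^+$ is $\{\gamma\in\Psi^+:\beta\le\gamma\}$. If $\Psi$ is irreducible, the multiplicity of $\alpha\in\Delta$ is its coefficient in the highest root of $\Psi^+$, and the abelian nilradicals of $\Psi^+$ are the empty ideal and the maximal abelian ideals that are generated by a simple root of multiplicity $1$. Then every face ideal of $\Phi^+$ is an abelian nilradical of some irreducible root subsystem of $\Phi$. Precisely, for every $\emptyset\neq S\subseteq\Pi$: 1. $\Psi=\Phi((\Pi\setminus S)^\circ_\theta)$ is an irreducible component of $\Phi((\Pi\setminus S)^\circ)$, with simple system $(\Pi\setminus S)^\circ_\theta$. In the positive system of $\Psi$ relative to this simple system, $I_{F_S}$ is an abelian nilradical, it is the principal ideal generated by the simple root $\theta$, and $\theta$ has multiplicity $1$. 2. $(\Pi\setminus S)^\circ$ is a simple system of the (possibly reducible) root subsystem $\Phi((\Pi\setminus S)^\circ)$; in the corresponding positive system $I_{F_S}$ is also the principal ideal generated by $\theta$, and the largest coefficient of $\theta$ in the elements of $\Phi((\Pi\setminus S)^\circ)$ is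 $1$. -/

import Mathlib

noncomputable section

/-!
Root systems are Mathlib's `RootPairing`s over `ℝ`; sets of roots are given as sets of indices.
-/
namespace RootFaces

variable {ι M N : Type*} [AddCommGroup M] [Module ℝ M] [AddCommGroup N] [Module ℝ N]

section Subsystems

variable (P : RootPairing ι ℝ M N)

/-- A root subsystem: a set of roots that is stable under its own reflections. -/
def IsSubsystem (Ψ : Set ι) : Prop :=
  ∀ i ∈ Ψ, ∀ j ∈ Ψ, P.reflectionPerm i j ∈ Ψ

/-- The root subsystem `Φ(A)` generated by a set of roots `A`, that is, the smallest root subsystem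
containing `A`. -/
def generated (A : Set ι) : Set ι :=
  ⋂₀ {Ψ | IsSubsystem P Ψ ∧ A ⊆ Ψ}

/-- A set of roots is irreducible if it is not empty and is not the union of two disjoint nonempty
mutually orthogonal subsets. -/
def IsIrreducibleSet (Ψ : Set ι) : Prop :=
  Ψ.Nonempty ∧ ∀ K ⊆ Ψ, K.Nonempty → (Ψ \ K).Nonempty →
    ∃ i ∈ K, ∃ j ∈ Ψ \ K, ¬ P.IsOrthogonal i j

/-- `Ψ'` is an irreducible component of the root subsystem `Ψ`. -/
def IsIrreducibleComponent (Ψ' Ψ : Set ι) : Prop :=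
  Ψ' ⊆ Ψ ∧ IsSubsystem P Ψ' ∧ IsIrreducibleSet P Ψ' ∧
    ∀ i ∈ Ψ', ∀ j ∈ Ψ \ Ψ', P.IsOrthogonal i j

/-- `Δ` is a simple system of the root subsystem `Ψ`: it is a linearly independent subset of `Ψ`,
and each root of `Ψ` is a combination of elements of `Δ` whose coefficients are integers, either all
nonnegative or all nonpositive. -/
def IsSimpleSystem (Ψ Δ : Set ι) : Prop :=
  Δ ⊆ Ψ ∧ LinearIndepOn ℝ P.root Δ ∧
    ∀ i ∈ Ψ, P.root i ∈ AddSubmonoid.closure (P.root '' Δ) ∨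
      -P.root i ∈ AddSubmonoid.closure (P.root '' Δ)

/-- The positive system of `Ψ` relative to the simple system `Δ`. -/
def posRoots (Ψ Δ : Set ι) : Set ι :=
  {i ∈ Ψ | P.root i ∈ AddSubmonoid.closure (P.root '' Δ)}

/-- The partial order of a positive system `Pos`: `i ≤ j` if the difference of the roots lies
in the `ℕ`-span of `Pos`. -/
def RootLE (Pos : Set ι) (i j : ι) : Prop :=
  P.root j - P.root i ∈ AddSubmonoid.closure (P.root '' Pos)

/-- `θ` is the highest root of the positive system `Pos`. -/
def IsHighestRoot (Pos : Set ι) (θ : ι) : Prop :=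
  θ ∈ Pos ∧ ∀ i ∈ Pos, RootLE P Pos i θ

/-- The principal ideal `(β^≤)` of the positive system `Pos` generated by `β`. -/
def principalIdeal (Pos : Set ι) (β : ι) : Set ι :=
  {i ∈ Pos | RootLE P Pos β i}

/-- The abelian ideals of the positive system `Pos` of the root subsystem `Ψ`. -/
def IsAbelianIdeal (Ψ Pos I : Set ι) : Prop :=
  I ⊆ Pos ∧ (∀ i ∈ I, ∀ j ∈ Pos, RootLE P Pos i j → j ∈ I) ∧
    ∀ i ∈ I, ∀ j ∈ I, ∀ k ∈ Ψ, P.root i + P.root j ≠ P.root k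

/-- `c` is the coefficient of the root `α` in the expression of the vector `x` as a linear
combination of the roots in `Δ` (which is unique if `Δ` is linearly independent). -/
def HasCoeff (Δ : Set ι) (α : ι) (x : M) (c : ℝ) : Prop :=
  ∃ f : ι →₀ ℝ, (f.support : Set ι) ⊆ Δ ∧ Finsupp.linearCombination ℝ P.root f = x ∧ f α = c

/-- The simple root `α` has multiplicity `m` in the irreducible root subsystem `Ψ` with simple
system `Δ`: it has coefficient `m` in the highest root. -/
def HasMultiplicity (Ψ Δ : Set ι) (α : ι) (m : ℝ) : Prop :=
  ∃ μ, IsHighestRoot P (posRoots P Ψ Δ) μ ∧ HasCoeff P Δ α (P.root μ) m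

/-- The abelian nilradicals of the positive system, with simple system `Δ`, of an irreducible root
subsystem `Ψ`: the empty ideal and the maximal abelian ideals that are generated by a simple
root of multiplicity `1`. -/
def IsAbelianNilradical (Ψ Δ I : Set ι) : Prop :=
  I = ∅ ∨
    (Maximal (IsAbelianIdeal P Ψ (posRoots P Ψ Δ)) I ∧
      ∃ α ∈ Δ, HasMultiplicity P Ψ Δ α 1 ∧ I = principalIdeal P (posRoots P Ψ Δ) α)

/-- The connected component of `θ` in the graph with vertex set `A`, where two roots are joined if
they are not orthogonal. -/
def connectedPart (A : Set ι) (θ : ι) : Set ι :=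
  {i | Relation.ReflTransGen (fun x y => x ∈ A ∧ y ∈ A ∧ ¬ P.IsOrthogonal x y) θ i}

end Subsystems

section Faces

variable {P : RootPairing ι ℝ M N} (b : P.Base)

/-- The standard parabolic face `F_S` of the root polytope: it consists of the points of the
polytope whose coefficient at each `α ∈ S` equals `m_α`, the coefficient of the highest root `θ`. -/
def parabolicFace [P.IsRootSystem] (θ : ι) (S : Set b.support) : Set M :=
  ⋂ α ∈ S, {x | b.toWeightBasis.coord α x = b.toWeightBasis.coord α (P.root θ)} ∩
    convexHull ℝ (Set.range P.root)

/-- The face ideal `I_{F_S}`: the set of all roots that lie in `F_S`. -/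
def faceIdeal [P.IsRootSystem] (θ : ι) (S : Set b.support) : Set ι :=
  {i | P.root i ∈ parabolicFace b θ S}

/-- For a set `A` of simple roots, the set of roots `A° = {θ} ∪ -A`. Here
`P.reflectionPerm i i` is the index of the root `-P.root i`. -/
def opp (θ : ι) (A : Set b.support) : Set ι :=
  {θ} ∪ (fun i : b.support => P.reflectionPerm i i) '' A

/-- The set `A°_θ`: the connected component of `θ` in `A°`. -/
def oppTheta (θ : ι) (A : Set b.support) : Set ι :=
  connectedPart P (opp b θ A) θ

end Faces

end RootFaces

end

/-!
Write `Δ` for the simple system of the ambient root system and `A = {θ} ∪ -(Δ \ S)`.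

Let `Ψ` be the set of roots that are integral multiples of `θ` modulo the span of `Δ \ S`
(`faceSubsystem`); it is a subsystem. In a root the coefficient of an element of `S` is at most
its coefficient in `θ` in absolute value, so that the multiple is `θ`, `0` or `-θ`. A root congruent
to `θ` is `θ` minus a nonnegative combination of `Δ \ S`, since `θ` is the highest root, and the
coefficients of a root congruent to `0` have the same sign. Hence `A` is a simple system of `Ψ`
(`isSimpleSystem_insertNeg`). A subsystem is generated by each of its simple systems
(`IsSimpleSystem.generated_eq`), thus `Ψ = Φ(A)`. The roots of the face are those congruent to `θ`,
that is, those in which the simple root `θ` has its largest possible coefficient `1`, and these form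
the principal ideal generated by `θ` (`IsSimpleSystem.mem_principalIdeal_iff`).

The connected component `C` of `θ` in `A` is orthogonal to the rest of `A`, so that
`Φ(A) = Φ(C) ∪ Φ(A \ C)` (`generated_union_subset`), and `Φ(C)` is an irreducible component with
simple system `C`. The simple root `θ` does not occur in the roots of `Φ(A \ C)`, hence the face
ideal lies in `Φ(C)`. Existence of the highest root of `Φ(C)`
(`IsSimpleSystem.exists_isHighestRoot`) gives `θ` multiplicity `1`. Finally the ideal is maximal
among abelian ideals (`IsSimpleSystem.maximal_principalIdeal`): in a larger one, a maximal root `β`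
not involving `θ` can be raised only by `θ` itself, and then `β + θ` is a root. This and the highest
root rest on `IsSimpleSystem.exists_pairing_neg`: by connectedness, a positive root without full
support forms an obtuse angle with some simple root.
-/

noncomputable section

namespace RootFaces

variable {ι M N : Type*} [AddCommGroup M] [Module ℝ M] [AddCommGroup N] [Module ℝ N]

/-! ### Coefficients with respect to a linearly independent family -/

/-- The functionals `e i`, for `i ∈ Δ`, are dual to the vectors `v i`, for `i ∈ Δ`. Hence `e i x` is
the coefficient of `v i` in every vector `x` of the span of these vectors. The functionals with
index outside `Δ` are arbitrary. -/
structure IsDualFamily (v : ι → M) (Δ : Set ι) (e : ι → M →ₗ[ℝ] ℝ) : Prop where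
  apply_self : ∀ i ∈ Δ, e i (v i) = 1
  apply_of_ne : ∀ i ∈ Δ, ∀ j ∈ Δ, j ≠ i → e i (v j) = 0

section Coefficients

variable {v : ι → M} {Δ : Set ι} {e : ι → M →ₗ[ℝ] ℝ}

lemma exists_isDualFamily (h : LinearIndepOn ℝ v Δ) : ∃ e, IsDualFamily v Δ e := by
  have h1 : ∀ i : Δ, ∃ g : M →ₗ[ℝ] ℝ, ∀ j : Δ, g (v j) = Finsupp.single j (1 : ℝ) i := by
    intro i
    obtain ⟨g, hg⟩ := LinearMap.exists_extend
      ((Finsupp.lapply i : (Δ →₀ ℝ) →ₗ[ℝ] ℝ) ∘ₗ h.linearIndependent.repr)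
    refine ⟨g, fun j => ?_⟩
    have := LinearMap.congr_fun hg ⟨v j, Submodule.subset_span (Set.mem_range_self j)⟩
    simp only [LinearMap.comp_apply, Submodule.subtype_apply,
      Finsupp.lapply_apply] at this
    rw [this, h.linearIndependent.repr_eq_single j _ rfl]
  choose g hg using h1
  classical
  refine ⟨fun i => if hi : i ∈ Δ then g ⟨i, hi⟩ else 0, ⟨?_, ?_⟩⟩
  · intro i hi
    simp [hi, hg ⟨i, hi⟩ ⟨i, hi⟩]
  · intro i hi j hj hij
    have : (⟨j, hj⟩ : Δ) ≠ ⟨i, hi⟩ := by simpa using hij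
    simp [hi, hg ⟨i, hi⟩ ⟨j, hj⟩, hij]

namespace IsDualFamily

lemma mono {C : Set ι} (h : IsDualFamily v Δ e) (hC : C ⊆ Δ) : IsDualFamily v C e :=
  ⟨fun i hi => h.apply_self i (hC hi), fun i hi j hj => h.apply_of_ne i (hC hi) j (hC hj)⟩

lemma apply_eq_zero_of_mem_span (h : IsDualFamily v Δ e) {C : Set ι} (hC : C ⊆ Δ) {i : ι}
    (hi : i ∈ Δ) (hiC : i ∉ C) {x : M} (hx : x ∈ Submodule.span ℝ (v '' C)) : e i x = 0 := by
  induction hx using Submodule.span_induction with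
  | mem x hx =>
    obtain ⟨j, hj, rfl⟩ := hx
    exact h.apply_of_ne i hi j (hC hj) (fun hij => hiC (hij ▸ hj))
  | zero => simp
  | add x y _ _ hx hy => simp [hx, hy]
  | smul c x _ hx => simp [hx]

lemma exists_nat (h : IsDualFamily v Δ e) {i : ι} (hi : i ∈ Δ) {x : M}
    (hx : x ∈ AddSubmonoid.closure (v '' Δ)) : ∃ n : ℕ, e i x = n := by
  induction hx using AddSubmonoid.closure_induction with
  | mem x hx =>
    obtain ⟨j, hj, rfl⟩ := hx
    by_cases hij : j = i
    · exact ⟨1, by simp [hij, h.apply_self i hi]⟩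
    · exact ⟨0, by simp [h.apply_of_ne i hi j hj hij]⟩
  | zero => exact ⟨0, by simp⟩
  | add x y _ _ hx hy =>
    obtain ⟨m, hm⟩ := hx
    obtain ⟨n, hn⟩ := hy
    exact ⟨m + n, by simp [hm, hn]⟩

lemma nonneg (h : IsDualFamily v Δ e) {i : ι} (hi : i ∈ Δ) {x : M}
    (hx : x ∈ AddSubmonoid.closure (v '' Δ)) : 0 ≤ e i x := by
  obtain ⟨n, hn⟩ := h.exists_nat hi hx
  simp [hn]

variable [Fintype ι]

open Classical in
lemma sum_eq (h : IsDualFamily v Δ e) {x : M} (hx : x ∈ Submodule.span ℝ (v '' Δ)) :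
    ∑ i with i ∈ Δ, e i x • v i = x := by
  induction hx using Submodule.span_induction with
  | mem x hx =>
    obtain ⟨j, hj, rfl⟩ := hx
    rw [Finset.sum_eq_single j]
    · simp [h.apply_self j hj]
    · intro i hi hij
      simp [h.apply_of_ne i (by simpa using hi) j hj hij.symm]
    · simp [hj]
  | zero => simp
  | add x y _ _ hx hy => simp [add_smul, Finset.sum_add_distrib, hx, hy]
  | smul c x _ hx => simp [mul_smul, ← Finset.smul_sum, hx]

/-- A vector of the `ℝ`-span of `Δ` whose coefficients are natural numbers, and vanish outside a
subset `C`, lies in the `ℕ`-span of `C`. -/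
lemma mem_closure (h : IsDualFamily v Δ e) {C : Set ι} {x : M}
    (hx : x ∈ Submodule.span ℝ (v '' Δ)) (hnat : ∀ i ∈ Δ, ∃ n : ℕ, e i x = n)
    (hzero : ∀ i ∈ Δ, i ∉ C → e i x = 0) : x ∈ AddSubmonoid.closure (v '' C) := by
  classical
  rw [← h.sum_eq hx]
  refine sum_mem fun i hi => ?_
  have hi' : i ∈ Δ := by simpa using hi
  by_cases hiC : i ∈ C
  · obtain ⟨n, hn⟩ := hnat i hi'
    rw [hn, Nat.cast_smul_eq_nsmul]
    exact nsmul_mem (AddSubmonoid.subset_closure (Set.mem_image_of_mem v hiC)) n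
  · simp [hzero i hi' hiC]

end IsDualFamily

lemma closure_le_span (Δ : Set ι) {x : M} (hx : x ∈ AddSubmonoid.closure (v '' Δ)) :
    x ∈ Submodule.span ℝ (v '' Δ) :=
  (AddSubmonoid.closure_le (S := (Submodule.span ℝ (v '' Δ)).toAddSubmonoid)).2
    Submodule.subset_span hx

end Coefficients

section Pairing

variable (P : RootPairing ι ℝ M N)

lemma root_reflectionPerm_eq (i j : ι) :
    P.root (P.reflectionPerm i j) = P.root j - P.pairing j i • P.root i := by
  rw [P.root_reflectionPerm, P.reflection_apply_root]

lemma exists_int_pairing [P.IsCrystallographic] (i j : ι) : ∃ k : ℤ, P.pairing i j = k :=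
  ⟨P.pairingIn ℤ i j, by rw [← P.algebraMap_pairingIn ℤ]; simp⟩

variable [Finite ι]

/-- A finite root system carries a Weyl-invariant Euclidean form. -/
lemma exists_form [P.IsRootSystem] : ∃ B : LinearMap.BilinForm ℝ M,
    (∀ x y, B x y = B y x) ∧ (∀ x, x ≠ 0 → 0 < B x x) ∧
      ∀ i j, 2 * B (P.root i) (P.root j) = P.pairing i j * B (P.root j) (P.root j) := by
  have := Fintype.ofFinite ι
  refine ⟨P.RootForm, fun x y => (P.rootForm_symmetric.eq x y), fun x hx => ?_, fun i j => ?_⟩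
  · exact P.rootForm_pos_of_ne_zero (by simp) hx
  · exact P.toInvariantForm.two_mul_apply_root_root i j

lemma pairing_pos_comm [P.IsRootSystem] {i j : ι} (h : 0 < P.pairing i j) :
    0 < P.pairing j i := by
  obtain ⟨B, hs, hp, hB⟩ := exists_form P
  have h1 := hB i j
  have h2 := hB j i
  have h3 := hp _ (P.ne_zero i)
  have h4 := hp _ (P.ne_zero j)
  rw [hs (P.root j)] at h2
  have h5 : 0 < P.pairing j i * B (P.root i) (P.root i) := by
    rw [← h2, h1]; positivity
  exact (pos_iff_pos_of_mul_pos h5).2 h3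

lemma pairing_neg_comm [P.IsRootSystem] {i j : ι} (h : P.pairing i j < 0) :
    P.pairing j i < 0 := by
  have := pairing_pos_comm P (i := i) (j := P.reflectionPerm j j) (by simpa using h)
  simpa using this

end Pairing

/-! ### Subsystems generated by a set of roots -/

section Generated

variable (P : RootPairing ι ℝ M N) {A C Ψ : Set ι}

lemma subset_generated : A ⊆ generated P A :=
  Set.subset_sInter fun _ h => h.2

lemma generated_subset (hΨ : IsSubsystem P Ψ) (h : A ⊆ Ψ) : generated P A ⊆ Ψ :=
  Set.sInter_subset_of_mem ⟨hΨ, h⟩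

lemma isSubsystem_generated : IsSubsystem P (generated P A) := by
  intro i hi j hj Ψ hΨ
  exact hΨ.1 i (hi Ψ hΨ) j (hj Ψ hΨ)

lemma generated_mono (h : C ⊆ A) : generated P C ⊆ generated P A :=
  generated_subset P (isSubsystem_generated P) (h.trans (subset_generated P))

lemma root_mem_span_of_mem_generated {i : ι} (hi : i ∈ generated P A) :
    P.root i ∈ Submodule.span ℝ (P.root '' A) := by
  refine generated_subset P (Ψ := {i | P.root i ∈ Submodule.span ℝ (P.root '' A)}) ?_ ?_ hi
  · intro i hi j hj
    simp only [Set.mem_ofPred_eq, root_reflectionPerm_eq] at hi hj ⊢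
    exact sub_mem hj (Submodule.smul_mem _ _ hi)
  · exact fun j hj => Submodule.subset_span (Set.mem_image_of_mem _ hj)

lemma isSubsystem_orthogonal (K : Set ι) :
    IsSubsystem P {i | ∀ k ∈ K, P.IsOrthogonal i k} := by
  intro i hi j hj k hk
  rw [RootPairing.isOrthogonal_iff_pairing_eq_zero, ← RootPairing.root_coroot'_eq_pairing,
    root_reflectionPerm_eq]
  simp [(hi k hk).1, (hj k hk).1]

lemma not_isOrthogonal_self (i : ι) : ¬ P.IsOrthogonal i i := by
  intro h
  simpa using h.1

lemma isOrthogonal_of_mem_generated (h : ∀ i ∈ C, ∀ j ∈ A, P.IsOrthogonal i j) :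
    ∀ i ∈ generated P C, ∀ j ∈ generated P A, P.IsOrthogonal i j := by
  have h1 : generated P A ⊆ {j | ∀ i ∈ C, P.IsOrthogonal j i} :=
    generated_subset P (isSubsystem_orthogonal P C) fun j hj i hi => (h i hi j hj).symm
  exact generated_subset P (isSubsystem_orthogonal P (generated P A))
    fun i hi j hj => (h1 hj i hi).symm

/-- If `C` and `A` are orthogonal, then `Φ(C ∪ A)` is the union of `Φ(C)` and `Φ(A)`. -/
lemma generated_union_subset (h : ∀ i ∈ C, ∀ j ∈ A, P.IsOrthogonal i j) :
    generated P (C ∪ A) ⊆ generated P C ∪ generated P A := by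
  have h1 := isOrthogonal_of_mem_generated P h
  refine generated_subset P ?_
    (Set.union_subset_union (subset_generated P) (subset_generated P))
  rintro i (hi | hi) j (hj | hj)
  · exact Or.inl (isSubsystem_generated P i hi j hj)
  · rw [P.reflectionPerm_eq_of_pairing_eq_zero (h1 i hi j hj).2]
    exact Or.inr hj
  · rw [P.reflectionPerm_eq_of_pairing_eq_zero (h1 j hj i hi).1]
    exact Or.inl hj
  · exact Or.inr (isSubsystem_generated P i hi j hj)

lemma isIrreducibleSet_generated (hC : IsIrreducibleSet P C) :
    IsIrreducibleSet P (generated P C) := by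
  refine ⟨hC.1.mono (subset_generated P), fun K hK hKne hKne' => ?_⟩
  by_contra! hcon
  -- A subset of `Φ(C)` containing `C` has empty orthogonal complement in `Φ(C)`.
  have key : ∀ L : Set ι, C ⊆ L → ∀ j ∈ generated P C, ¬ ∀ i ∈ L, P.IsOrthogonal i j := by
    intro L hL j hj hLj
    have h1 : generated P C ⊆ {i | ∀ k ∈ ({j} : Set ι), P.IsOrthogonal i k} :=
      generated_subset P (isSubsystem_orthogonal P {j})
        fun i hi k hk => by rw [Set.mem_singleton_iff.1 hk]; exact hLj i (hL hi)
    exact not_isOrthogonal_self P j (h1 hj j rfl)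
  by_cases h1 : (C ∩ K).Nonempty
  · by_cases h2 : (C \ (C ∩ K)).Nonempty
    · obtain ⟨i, hi, j, hj, hij⟩ := hC.2 _ Set.inter_subset_left h1 h2
      exact hij (hcon i hi.2 j ⟨subset_generated P hj.1, fun h => hj.2 ⟨hj.1, h⟩⟩)
    · obtain ⟨j, hj⟩ := hKne'
      refine key K (fun i hi => ?_) j hj.1 fun i hi => hcon i hi j hj
      by_contra hiK
      exact h2 ⟨i, hi, fun h => hiK h.2⟩
  · obtain ⟨j, hj⟩ := hKne
    refine key (generated P C \ K) (fun i hi => ⟨subset_generated P hi, fun h => h1 ⟨i, hi, h⟩⟩)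
      j (hK hj) fun i hi => (hcon j hj i hi).symm

end Generated

section ConnectedPart

variable (P : RootPairing ι ℝ M N) {A : Set ι} {a : ι}

lemma mem_connectedPart : a ∈ connectedPart P A a := Relation.ReflTransGen.refl

lemma connectedPart_subset (ha : a ∈ A) : connectedPart P A a ⊆ A := by
  intro i hi
  cases hi with
  | refl => exact ha
  | tail _ h => exact h.2.1

lemma isOrthogonal_of_notMem_connectedPart (ha : a ∈ A) :
    ∀ i ∈ connectedPart P A a, ∀ j ∈ A \ connectedPart P A a, P.IsOrthogonal i j := by
  intro i hi j hj
  by_contra hij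
  exact hj.2 (Relation.ReflTransGen.tail hi ⟨connectedPart_subset P ha hi, hj.1, hij⟩)

lemma isIrreducibleSet_connectedPart :
    IsIrreducibleSet P (connectedPart P A a) := by
  refine ⟨⟨a, mem_connectedPart P⟩, fun K hK hKne hKne' => ?_⟩
  by_contra! hcon
  -- A path starting at `a` cannot leave a set that is orthogonal to its complement.
  have key : ∀ L ⊆ connectedPart P A a, a ∈ L →
      (∀ i ∈ L, ∀ j ∈ connectedPart P A a \ L, P.IsOrthogonal i j) →
      connectedPart P A a ⊆ L := by
    intro L hL haL horth i hi
    induction hi with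
    | refl => exact haL
    | tail h h' ih =>
      by_contra hcL
      exact h'.2.2 (horth _ ih _ ⟨Relation.ReflTransGen.tail h h', hcL⟩)
  by_cases haK : a ∈ K
  · obtain ⟨j, hj⟩ := hKne'
    exact hj.2 (key K hK haK hcon hj.1)
  · obtain ⟨i, hi⟩ := hKne
    refine (key _ Set.sdiff_subset ⟨mem_connectedPart P, haK⟩ (fun k hk j hj => ?_) (hK hi)).2 hi
    have hjK : j ∈ K := by
      by_contra hjK
      exact hj.2 ⟨hj.1, hjK⟩
    exact (hcon j hjK k hk).symm

/-- A connected component of a set of roots generates an irreducible component. -/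
lemma isIrreducibleComponent_connectedPart (ha : a ∈ A) :
    IsIrreducibleComponent P (generated P (connectedPart P A a)) (generated P A) := by
  have hC := connectedPart_subset P ha
  refine ⟨generated_mono P hC, isSubsystem_generated P,
    isIrreducibleSet_generated P (isIrreducibleSet_connectedPart P), fun i hi j hj => ?_⟩
  have horth := isOrthogonal_of_notMem_connectedPart P ha
  have h1 := generated_union_subset P horth
  rw [Set.union_sdiff_cancel hC] at h1
  exact isOrthogonal_of_mem_generated P horth i hi j ((h1 hj.1).resolve_left hj.2)

end ConnectedPart

/-! ### Simple systems of subsystems -/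

section SimpleSystem

variable (P : RootPairing ι ℝ M N) {Ψ Δ : Set ι} {e : ι → M →ₗ[ℝ] ℝ}

lemma closure_posRoots (h : Δ ⊆ Ψ) :
    AddSubmonoid.closure (P.root '' posRoots P Ψ Δ) = AddSubmonoid.closure (P.root '' Δ) := by
  refine le_antisymm (AddSubmonoid.closure_le.2 ?_) (AddSubmonoid.closure_mono ?_)
  · rintro _ ⟨i, hi, rfl⟩
    exact hi.2
  · rintro _ ⟨i, hi, rfl⟩
    exact ⟨i, ⟨h hi, AddSubmonoid.subset_closure ⟨i, hi, rfl⟩⟩, rfl⟩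

lemma rootLE_posRoots_iff (h : Δ ⊆ Ψ) {i j : ι} : RootLE P (posRoots P Ψ Δ) i j ↔
    P.root j - P.root i ∈ AddSubmonoid.closure (P.root '' Δ) := by
  rw [RootLE, closure_posRoots P h]

variable {P}

namespace IsSimpleSystem

lemma root_mem_span (hΔ : IsSimpleSystem P Ψ Δ) {i : ι} (hi : i ∈ Ψ) :
    P.root i ∈ Submodule.span ℝ (P.root '' Δ) := by
  rcases hΔ.2.2 i hi with h | h
  · exact closure_le_span Δ h
  · simpa using closure_le_span Δ h

/-- A root with one positive coefficient is positive. -/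
lemma mem_posRoots (hΔ : IsSimpleSystem P Ψ Δ) (he : IsDualFamily P.root Δ e) {i δ : ι}
    (hi : i ∈ Ψ) (hδ : δ ∈ Δ) (hpos : 0 < e δ (P.root i)) : i ∈ posRoots P Ψ Δ := by
  refine ⟨hi, (hΔ.2.2 i hi).resolve_right fun h => ?_⟩
  have := he.nonneg hδ h
  rw [map_neg] at this
  linarith

lemma subset_posRoots (hΔ : IsSimpleSystem P Ψ Δ) : Δ ⊆ posRoots P Ψ Δ :=
  fun _ hi => ⟨hΔ.1 hi, AddSubmonoid.subset_closure (Set.mem_image_of_mem _ hi)⟩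

/-- Distinct simple roots form an obtuse angle. -/
lemma pairing_nonpos [P.IsCrystallographic] (hΔ : IsSimpleSystem P Ψ Δ) (hΨ : IsSubsystem P Ψ)
    {i j : ι} (hi : i ∈ Δ) (hj : j ∈ Δ) (hij : i ≠ j) : P.pairing i j ≤ 0 := by
  by_contra! hpos
  obtain ⟨e, he⟩ := exists_isDualFamily hΔ.2.1
  -- Otherwise the reflection of `i` in `j` has coefficients of both signs.
  have h1 : P.reflectionPerm j i ∈ posRoots P Ψ Δ := by
    refine hΔ.mem_posRoots he (hΨ j (hΔ.1 hj) i (hΔ.1 hi)) hi ?_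
    rw [root_reflectionPerm_eq]
    simp [he.apply_self i hi, he.apply_of_ne i hi j hj hij.symm]
  have h2 := he.nonneg hj h1.2
  simp only [root_reflectionPerm_eq, map_sub, map_smul, he.apply_self j hj,
    he.apply_of_ne j hj i hi hij, smul_eq_mul] at h2
  linarith

open Classical in
lemma sum_smul_root [Fintype ι] (hΔ : IsSimpleSystem P Ψ Δ) (he : IsDualFamily P.root Δ e) {i : ι}
    (hi : i ∈ Ψ) : ∑ δ with δ ∈ Δ, e δ (P.root i) • P.root δ = P.root i :=
  he.sum_eq (hΔ.root_mem_span hi)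

open Classical in
lemma pairing_eq_sum [Fintype ι] (hΔ : IsSimpleSystem P Ψ Δ) (he : IsDualFamily P.root Δ e) {i : ι}
    (hi : i ∈ Ψ) (j : ι) :
    P.pairing i j = ∑ δ with δ ∈ Δ, e δ (P.root i) * P.pairing δ j := by
  rw [← RootPairing.root_coroot'_eq_pairing]
  conv_lhs => rw [← hΔ.sum_smul_root he hi]
  simp

variable [Finite ι]

lemma exists_pairing_pos (hΔ : IsSimpleSystem P Ψ Δ) (he : IsDualFamily P.root Δ e)
    [P.IsRootSystem] {i : ι} (hi : i ∈ posRoots P Ψ Δ) :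
    ∃ δ ∈ Δ, 0 < e δ (P.root i) ∧ 0 < P.pairing i δ := by
  classical
  have := Fintype.ofFinite ι
  by_contra! hcon
  have h2 : P.pairing i i ≤ 0 := by
    rw [hΔ.pairing_eq_sum he hi.1 i]
    refine Finset.sum_nonpos fun δ hδ => ?_
    have hδ' : δ ∈ Δ := by simpa using hδ
    have h0 := he.nonneg hδ' hi.2
    rcases h0.eq_or_lt with h | h
    · simp [← h]
    · refine mul_nonpos_of_nonneg_of_nonpos h0 ?_
      by_contra! hp
      exact absurd (pairing_pos_comm P hp) (not_lt.2 (hcon δ hδ' h))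
  rw [P.pairing_same] at h2
  linarith

lemma exists_coeff_pos (hΔ : IsSimpleSystem P Ψ Δ) (he : IsDualFamily P.root Δ e)
    {i : ι} (hi : i ∈ posRoots P Ψ Δ) : ∃ δ ∈ Δ, 0 < e δ (P.root i) := by
  classical
  have := Fintype.ofFinite ι
  by_contra! hcon
  have := hΔ.pairing_eq_sum he hi.1 i
  rw [Finset.sum_eq_zero, P.pairing_same] at this
  · norm_num at this
  · intro δ hδ
    have hδ' : δ ∈ Δ := by simpa using hδ
    simp [le_antisymm (hcon δ hδ') (he.nonneg hδ' hi.2)]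

lemma exists_coeff_pos_of_ne [P.IsReduced] (hΔ : IsSimpleSystem P Ψ Δ)
    (he : IsDualFamily P.root Δ e) {i δ : ι} (hi : i ∈ posRoots P Ψ Δ) (hδ : δ ∈ Δ)
    (hne : i ≠ δ) : ∃ γ ∈ Δ, γ ≠ δ ∧ 0 < e γ (P.root i) := by
  classical
  have := Fintype.ofFinite ι
  by_contra! hcon
  have h1 : P.root i ∈ AddSubmonoid.closure (P.root '' {δ}) :=
    he.mem_closure (hΔ.root_mem_span hi.1) (fun γ hγ => he.exists_nat hγ hi.2)
      fun γ hγ hγδ => le_antisymm (hcon γ hγ (by simpa using hγδ)) (he.nonneg hγ hi.2)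
  rw [Set.image_singleton, AddSubmonoid.mem_closure_singleton] at h1
  obtain ⟨n, hn⟩ := h1
  have h2 : P.root i ≠ -P.root δ := by
    intro h
    have := he.nonneg hδ hi.2
    rw [h, map_neg, he.apply_self δ hδ] at this
    linarith
  have h3 := RootPairing.IsReduced.linearIndependent P hne h2
  rw [LinearIndependent.pair_iff] at h3
  have h4 := (h3 1 (-(n : ℝ)) (by rw [← hn, one_smul, neg_smul, Nat.cast_smul_eq_nsmul]; simp)).1
  norm_num at h4

/-- A simple reflection maps a positive root other than its own simple root to a positive root. -/
lemma reflectionPerm_mem_posRoots [P.IsReduced] (hΔ : IsSimpleSystem P Ψ Δ)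
    (hΨ : IsSubsystem P Ψ) {i δ : ι} (hi : i ∈ posRoots P Ψ Δ) (hδ : δ ∈ Δ) (hne : i ≠ δ) :
    P.reflectionPerm δ i ∈ posRoots P Ψ Δ := by
  obtain ⟨e, he⟩ := exists_isDualFamily hΔ.2.1
  obtain ⟨γ, hγ, hγδ, hpos⟩ := hΔ.exists_coeff_pos_of_ne he hi hδ hne
  refine hΔ.mem_posRoots he (hΨ δ (hΔ.1 hδ) i hi.1) hγ ?_
  rw [root_reflectionPerm_eq]
  simpa [he.apply_of_ne γ hγ δ hδ hγδ.symm] using hpos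

/-- A root subsystem is generated by each of its simple systems. -/
lemma generated_eq [P.IsRootSystem] [P.IsCrystallographic] [P.IsReduced]
    (hΔ : IsSimpleSystem P Ψ Δ) (hΨ : IsSubsystem P Ψ) : generated P Δ = Ψ := by
  classical
  have := Fintype.ofFinite ι
  refine (generated_subset P hΨ hΔ.1).antisymm ?_
  obtain ⟨e, he⟩ := exists_isDualFamily hΔ.2.1
  -- Induction on the height: a positive root that is not simple is lowered by some simple
  -- reflection.
  have key : ∀ n : ℕ, ∀ i ∈ posRoots P Ψ Δ, ∑ δ with δ ∈ Δ, e δ (P.root i) ≤ n →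
      i ∈ generated P Δ := by
    intro n
    induction n with
    | zero =>
      intro i hi hn
      obtain ⟨δ, hδ, hpos⟩ := hΔ.exists_coeff_pos he hi
      have := Finset.single_le_sum (f := fun δ => e δ (P.root i)) (s := Finset.univ.filter (· ∈ Δ))
        (fun γ hγ => he.nonneg (by simpa using hγ) hi.2)
        (Finset.mem_filter.2 ⟨Finset.mem_univ δ, hδ⟩)
      simp only [Nat.cast_zero] at hn
      linarith
    | succ n ih =>
      intro i hi hn
      obtain ⟨δ, hδ, -, hpos⟩ := hΔ.exists_pairing_pos he hi
      by_cases hne : i = δ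
      · exact subset_generated P (hne ▸ hδ)
      obtain ⟨k, hk⟩ := exists_int_pairing P i δ
      have hk1 : (1 : ℝ) ≤ P.pairing i δ := by
        rw [hk] at hpos ⊢
        exact_mod_cast hpos
      have hj := ih _ (hΔ.reflectionPerm_mem_posRoots hΨ hi hδ hne) (by
        have h1 : ∑ γ with γ ∈ Δ, e γ (P.root δ) = 1 := by
          rw [Finset.sum_eq_single δ, he.apply_self δ hδ]
          · intro γ hγ hγδ
            exact he.apply_of_ne γ (by simpa using hγ) δ hδ hγδ.symm
          · simp [hδ]
        simp only [root_reflectionPerm_eq, map_sub, map_smul, smul_eq_mul, Finset.sum_sub_distrib,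
          ← Finset.mul_sum, h1]
        push_cast at hn
        linarith)
      have := isSubsystem_generated P δ (subset_generated P hδ) _ hj
      rwa [P.reflectionPerm_self] at this
  have key' : ∀ i ∈ posRoots P Ψ Δ, i ∈ generated P Δ := by
    intro i hi
    obtain ⟨n, hn⟩ := exists_nat_ge (∑ δ with δ ∈ Δ, e δ (P.root i))
    exact key n i hi hn
  intro i hi
  rcases hΔ.2.2 i hi with h | h
  · exact key' i ⟨hi, h⟩
  · have h1 := key' (P.reflectionPerm i i) ⟨hΨ i hi i hi, by simpa using h⟩
    have h2 := isSubsystem_generated P _ h1 _ h1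
    have h3 : P.reflectionPerm (P.reflectionPerm i i) (P.reflectionPerm i i) = i :=
      P.root.injective (by
        rw [P.root_reflectionPerm, P.reflection_apply_self, P.root_reflectionPerm,
          P.reflection_apply_self, neg_neg])
    rwa [h3] at h2

/-- A subset of a simple system is a simple system of the subsystem it generates. -/
lemma generated_of_subset (hΔ : IsSimpleSystem P Ψ Δ) (hΨ : IsSubsystem P Ψ) {C : Set ι}
    (hC : C ⊆ Δ) : IsSimpleSystem P (generated P C) C := by
  have := Fintype.ofFinite ι
  refine ⟨subset_generated P, hΔ.2.1.mono hC, fun i hi => ?_⟩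
  obtain ⟨e, he⟩ := exists_isDualFamily hΔ.2.1
  have hspan := root_mem_span_of_mem_generated P hi
  have hzero : ∀ δ ∈ Δ, δ ∉ C → e δ (P.root i) = 0 :=
    fun δ hδ hδC => he.apply_eq_zero_of_mem_span hC hδ hδC hspan
  have hspan' := Submodule.span_mono (R := ℝ) (Set.image_mono (f := P.root) hC) hspan
  refine (hΔ.2.2 i (generated_subset P hΨ (hC.trans hΔ.1) hi)).imp (fun h => ?_) fun h => ?_
  · exact he.mem_closure hspan' (fun δ hδ => he.exists_nat hδ h) hzero
  · exact he.mem_closure (neg_mem hspan') (fun δ hδ => he.exists_nat hδ h)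
      fun δ hδ hδC => by rw [map_neg, hzero δ hδ hδC, neg_zero]

end IsSimpleSystem
end SimpleSystem

/-! ### The highest root of an irreducible subsystem -/

section Highest

variable {P : RootPairing ι ℝ M N} {Ψ Δ : Set ι} {e : ι → M →ₗ[ℝ] ℝ}

open Classical in
lemma IsDualFamily.sum_lt_sum_of_sub_mem_closure [Fintype ι] {i j : ι}
    (he : IsDualFamily P.root Δ e) (h : P.root j - P.root i ∈ AddSubmonoid.closure (P.root '' Δ))
    (hne : i ≠ j) : ∑ δ with δ ∈ Δ, e δ (P.root i) < ∑ δ with δ ∈ Δ, e δ (P.root j) := by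
  have h1 : ∀ δ ∈ Finset.univ.filter (· ∈ Δ), 0 ≤ e δ (P.root j - P.root i) :=
    fun δ hδ => he.nonneg (by simpa using hδ) h
  rw [← sub_pos, ← Finset.sum_sub_distrib]
  simp only [← map_sub]
  refine (Finset.sum_nonneg h1).lt_of_ne fun h0 => hne ?_
  rw [eq_comm, Finset.sum_eq_zero_iff_of_nonneg h1] at h0
  have h2 := he.sum_eq (closure_le_span Δ h)
  rw [Finset.sum_eq_zero fun δ hδ => by rw [h0 δ hδ, zero_smul]] at h2
  exact P.root.injective (sub_eq_zero.1 h2.symm).symm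

namespace IsSimpleSystem

/-- In an irreducible root system, a positive root whose support is not full is raised by some
simple reflection. -/
lemma exists_pairing_neg [Finite ι] [P.IsCrystallographic] (hΔ : IsSimpleSystem P Ψ Δ)
    (hΨ : IsSubsystem P Ψ) (hirr : IsIrreducibleSet P Δ) (he : IsDualFamily P.root Δ e) {i a : ι}
    (hi : i ∈ posRoots P Ψ Δ) (ha : a ∈ Δ) (h0 : e a (P.root i) = 0) :
    ∃ δ ∈ Δ, P.pairing i δ < 0 := by
  classical
  have := Fintype.ofFinite ι
  obtain ⟨γ, hγ, hγpos⟩ := hΔ.exists_coeff_pos he hi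
  -- Irreducibility joins the support of the root to a simple root outside it.
  obtain ⟨κ, ⟨hκ, hκpos⟩, δ, ⟨hδ, hδ0⟩, hκδ⟩ := hirr.2 {δ ∈ Δ | 0 < e δ (P.root i)}
    (fun _ h => h.1) ⟨γ, hγ, hγpos⟩ ⟨a, ha, fun h => h0.not_gt h.2⟩
  refine ⟨δ, hδ, ?_⟩
  have hδ0' : e δ (P.root i) = 0 :=
    le_antisymm (not_lt.1 fun h => hδ0 ⟨hδ, h⟩) (he.nonneg hδ hi.2)
  rw [hΔ.pairing_eq_sum he hi.1]
  refine Finset.sum_neg' (fun ε hε => ?_) ⟨κ, by simpa using hκ, ?_⟩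
  · have hε' : ε ∈ Δ := by simpa using hε
    by_cases hεδ : ε = δ
    · simp [hεδ, hδ0']
    · exact mul_nonpos_of_nonneg_of_nonpos (he.nonneg hε' hi.2)
        (hΔ.pairing_nonpos hΨ hε' hδ hεδ)
  · have hne : κ ≠ δ := by
      rintro rfl
      exact hκpos.ne' hδ0'
    refine mul_neg_of_pos_of_neg hκpos ((hΔ.pairing_nonpos hΨ hκ hδ hne).lt_of_ne fun h => ?_)
    have : Module.IsReflexive ℝ M := .of_isPerfPair P.toLinearMap
    exact hκδ (RootPairing.isOrthogonal_iff_pairing_eq_zero.2 h)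

/-- A simple reflection raises every positive root that it forms an obtuse angle with. -/
lemma rootLE_reflectionPerm [P.IsCrystallographic] (hΔ : IsSimpleSystem P Ψ Δ)
    {i δ : ι} (hδ : δ ∈ Δ) (h : P.pairing i δ < 0) :
    RootLE P (posRoots P Ψ Δ) i (P.reflectionPerm δ i) ∧ i ≠ P.reflectionPerm δ i := by
  rw [rootLE_posRoots_iff P hΔ.1, root_reflectionPerm_eq]
  obtain ⟨k, hk⟩ := exists_int_pairing P i δ
  constructor
  · have hk0 : 0 ≤ -k := by
      rw [hk] at h
      have : k < 0 := by exact_mod_cast h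
      lia
    obtain ⟨n, hn⟩ := Int.eq_ofNat_of_zero_le hk0
    have h1 : P.root i - P.pairing i δ • P.root δ - P.root i = n • P.root δ := by
      have : P.pairing i δ = -(n : ℝ) := by
        rw [hk, ← neg_neg k, hn]
        simp
      rw [this, neg_smul, Nat.cast_smul_eq_nsmul]
      abel
    rw [h1]
    exact nsmul_mem (AddSubmonoid.subset_closure (Set.mem_image_of_mem _ hδ)) n
  · intro hcon
    have h1 := congrArg P.root hcon
    rw [root_reflectionPerm_eq, eq_sub_iff_add_eq, add_eq_left, smul_eq_zero] at h1
    exact h1.elim h.ne (P.ne_zero δ)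

/-- The highest root exists: an irreducible subsystem has only one maximal positive root, since
maximal roots are dominant of full support, so that any two of them form an acute angle and one of
them minus the other is a root. -/
lemma exists_isHighestRoot [Finite ι] [P.IsRootSystem] [P.IsCrystallographic] [P.IsReduced]
    (hΔ : IsSimpleSystem P Ψ Δ) (hΨ : IsSubsystem P Ψ) (hirr : IsIrreducibleSet P Δ) :
    ∃ μ, IsHighestRoot P (posRoots P Ψ Δ) μ := by
  classical
  have := Fintype.ofFinite ι
  obtain ⟨e, he⟩ := exists_isDualFamily hΔ.2.1
  let IsMax : ι → Prop := fun μ => μ ∈ posRoots P Ψ Δ ∧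
    ∀ j ∈ posRoots P Ψ Δ, P.root j - P.root μ ∈ AddSubmonoid.closure (P.root '' Δ) → μ = j
  have hex : ∀ i ∈ posRoots P Ψ Δ, ∃ μ, IsMax μ ∧
      P.root μ - P.root i ∈ AddSubmonoid.closure (P.root '' Δ) := by
    intro i hi
    obtain ⟨μ, hμ, hmax⟩ := Set.exists_max_image
      {j ∈ posRoots P Ψ Δ | P.root j - P.root i ∈ AddSubmonoid.closure (P.root '' Δ)}
      (fun j => ∑ δ with δ ∈ Δ, e δ (P.root j)) (Set.toFinite _) ⟨i, hi, by simp⟩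
    refine ⟨μ, ⟨hμ.1, fun j hj hle => ?_⟩, hμ.2⟩
    by_contra hne
    refine (he.sum_lt_sum_of_sub_mem_closure hle hne).not_ge (hmax j ⟨hj, ?_⟩)
    rw [← sub_add_sub_cancel _ (P.root μ)]
    exact add_mem hle hμ.2
  have hdom : ∀ μ, IsMax μ → ∀ δ ∈ Δ, 0 ≤ P.pairing μ δ := by
    intro μ hμ δ hδ
    by_contra! hneg
    obtain ⟨h1, h2⟩ := hΔ.rootLE_reflectionPerm hδ hneg
    refine h2 (hμ.2 _ (hΔ.reflectionPerm_mem_posRoots hΨ hμ.1 hδ ?_)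
      ((rootLE_posRoots_iff P hΔ.1).1 h1))
    rintro rfl
    rw [P.pairing_same] at hneg
    norm_num at hneg
  have hfull : ∀ μ, IsMax μ → ∀ δ ∈ Δ, 0 < e δ (P.root μ) := by
    intro μ hμ δ hδ
    refine (he.nonneg hδ hμ.1.2).lt_of_ne fun h0 => ?_
    obtain ⟨γ, hγ, hneg⟩ := hΔ.exists_pairing_neg hΨ hirr he hμ.1 hδ h0.symm
    exact hneg.not_ge (hdom μ hμ γ hγ)
  have hacute : ∀ μ ν, IsMax μ → IsMax ν → 0 < P.pairing μ ν := by
    intro μ ν hμ hν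
    have hnonneg : ∀ δ ∈ Δ, 0 ≤ P.pairing δ ν := by
      intro δ hδ
      by_contra! hneg
      exact (pairing_neg_comm P hneg).not_ge (hdom ν hν δ hδ)
    obtain ⟨δ, hδ, -, hpos⟩ := hΔ.exists_pairing_pos he hν.1
    rw [hΔ.pairing_eq_sum he hμ.1.1]
    exact Finset.sum_pos' (fun γ hγ => mul_nonneg (he.nonneg (by simpa using hγ) hμ.1.2)
      (hnonneg γ (by simpa using hγ)))
      ⟨δ, by simpa using hδ, mul_pos (hfull μ hμ δ hδ) (pairing_pos_comm P hpos)⟩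
  have hone : ∀ μ ν, IsMax μ → IsMax ν → P.pairing μ ν = 1 → μ = ν := by
    intro μ ν hμ hν h1
    have h2 := hΔ.2.2 _ (hΨ ν hν.1.1 μ hμ.1.1)
    rw [root_reflectionPerm_eq, h1, one_smul, neg_sub] at h2
    exact h2.elim (fun h => (hν.2 μ hμ.1 h).symm) (fun h => hμ.2 ν hν.1 h)
  have huniq : ∀ μ ν, IsMax μ → IsMax ν → μ = ν := by
    intro μ ν hμ hν
    by_contra hne
    have h1 := hacute μ ν hμ hν
    have h2 := hacute ν μ hν hμ
    have hneg : P.root μ ≠ -P.root ν := by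
      intro h
      obtain ⟨δ, hδ, hpos⟩ := hΔ.exists_coeff_pos he hμ.1
      have := he.nonneg hδ hν.1.2
      rw [h, map_neg] at hpos
      linarith
    have h3 := P.pairingIn_pairingIn_mem_set_of_isCrystal_of_isRed' (i := μ) (j := ν)
      (fun h => hne (P.root.injective h)) hneg
    rw [← P.algebraMap_pairingIn ℤ] at h1 h2
    have h1' : 0 < P.pairingIn ℤ μ ν := by simpa using h1
    have h2' : 0 < P.pairingIn ℤ ν μ := by simpa using h2
    have h4 : P.pairingIn ℤ μ ν = 1 ∨ P.pairingIn ℤ ν μ = 1 := by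
      simp only [Set.mem_insert_iff, Set.mem_singleton_iff, Prod.mk.injEq] at h3
      lia
    rcases h4 with h | h
    · exact hne (hone μ ν hμ hν (by rw [← P.algebraMap_pairingIn ℤ, h]; simp))
    · exact hne (hone ν μ hν hμ (by rw [← P.algebraMap_pairingIn ℤ, h]; simp)).symm
  obtain ⟨i, hi⟩ := hirr.1
  obtain ⟨μ, hμ, -⟩ := hex i (hΔ.subset_posRoots hi)
  refine ⟨μ, hμ.1, fun j hj => ?_⟩
  obtain ⟨ν, hν, hle⟩ := hex j hj
  rw [rootLE_posRoots_iff P hΔ.1, huniq μ ν hμ hν]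
  exact hle

end IsSimpleSystem
end Highest

/-! ### Abelian nilradicals -/

section Nilradical

variable {P : RootPairing ι ℝ M N} {Ψ Δ : Set ι} {e : ι → M →ₗ[ℝ] ℝ}

lemma IsDualFamily.apply_eq_of_hasCoeff (he : IsDualFamily P.root Δ e) {a : ι} (ha : a ∈ Δ) {x : M}
    {c : ℝ} (h : HasCoeff P Δ a x c) : e a x = c := by
  obtain ⟨f, hf, rfl, rfl⟩ := h
  rw [Finsupp.linearCombination_apply, Finsupp.sum, map_sum, Finset.sum_eq_single a]
  · simp [he.apply_self a ha]
  · intro i hi hia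
    simp [he.apply_of_ne a ha i (hf hi) hia]
  · intro h
    simp [Finsupp.notMem_support_iff.1 h]

lemma IsDualFamily.hasCoeff [Finite ι] (he : IsDualFamily P.root Δ e) {a : ι} (ha : a ∈ Δ) {x : M}
    (hx : x ∈ Submodule.span ℝ (P.root '' Δ)) : HasCoeff P Δ a x (e a x) := by
  classical
  have := Fintype.ofFinite ι
  refine ⟨Finsupp.equivFunOnFinite.symm fun i => if i ∈ Δ then e i x else 0, ?_, ?_, ?_⟩
  · intro i hi
    by_contra hiΔ
    simp [hiΔ] at hi
  · rw [Finsupp.linearCombination_apply, Finsupp.sum_fintype _ _ (by simp)]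
    conv_rhs => rw [← he.sum_eq hx]
    rw [Finset.sum_filter]
    refine Finset.sum_congr rfl fun i _ => ?_
    by_cases hi : i ∈ Δ <;> simp [hi]
  · simp [ha]

namespace IsSimpleSystem

/-- If the coefficients of the simple root `a` are at most `1`, then the principal ideal generated
by `a` consists of the roots in which `a` has coefficient `1`. -/
lemma mem_principalIdeal_iff [Finite ι] (hΔ : IsSimpleSystem P Ψ Δ)
    (he : IsDualFamily P.root Δ e) {a : ι} (ha : a ∈ Δ) (hle : ∀ i ∈ Ψ, e a (P.root i) ≤ 1)
    {i : ι} :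
    i ∈ principalIdeal P (posRoots P Ψ Δ) a ↔ i ∈ Ψ ∧ e a (P.root i) = 1 := by
  have := Fintype.ofFinite ι
  rw [principalIdeal, Set.mem_ofPred_eq, rootLE_posRoots_iff P hΔ.1]
  constructor
  · rintro ⟨hi, hai⟩
    have := he.nonneg ha hai
    rw [map_sub, he.apply_self a ha] at this
    exact ⟨hi.1, le_antisymm (hle i hi.1) (by linarith)⟩
  · rintro ⟨hi, h1⟩
    have hpos := hΔ.mem_posRoots he hi ha (by rw [h1]; norm_num)
    refine ⟨hpos, he.mem_closure (sub_mem (hΔ.root_mem_span hi) (hΔ.root_mem_span (hΔ.1 ha)))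
      (fun δ hδ => ?_) fun δ hδ h => absurd hδ h⟩
    by_cases hδa : a = δ
    · exact ⟨0, by rw [map_sub, ← hδa, h1, he.apply_self a ha]; simp⟩
    · obtain ⟨n, hn⟩ := he.exists_nat hδ hpos.2
      exact ⟨n, by rw [map_sub, he.apply_of_ne δ hδ a ha hδa, hn, sub_zero]⟩

lemma hasMultiplicity_one [Finite ι] [P.IsRootSystem] [P.IsCrystallographic] [P.IsReduced]
    (hΔ : IsSimpleSystem P Ψ Δ) (hΨ : IsSubsystem P Ψ) (hirr : IsIrreducibleSet P Δ)
    (he : IsDualFamily P.root Δ e) {a : ι} (ha : a ∈ Δ) (hle : ∀ i ∈ Ψ, e a (P.root i) ≤ 1) :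
    HasMultiplicity P Ψ Δ a 1 := by
  obtain ⟨μ, hμ⟩ := hΔ.exists_isHighestRoot hΨ hirr
  refine ⟨μ, hμ, ?_⟩
  have h := ((hΔ.mem_principalIdeal_iff he ha hle).1
    ⟨hμ.1, hμ.2 a (hΔ.subset_posRoots ha)⟩).2
  exact h ▸ he.hasCoeff ha (hΔ.root_mem_span hμ.1.1)

lemma isAbelianIdeal_principalIdeal [Finite ι] (hΔ : IsSimpleSystem P Ψ Δ)
    (he : IsDualFamily P.root Δ e) {a : ι} (ha : a ∈ Δ) (hle : ∀ i ∈ Ψ, e a (P.root i) ≤ 1) :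
    IsAbelianIdeal P Ψ (posRoots P Ψ Δ) (principalIdeal P (posRoots P Ψ Δ) a) := by
  refine ⟨fun i hi => hi.1, fun i hi j hj hij => ⟨hj, ?_⟩, fun i hi j hj k hk h => ?_⟩
  · have h2 := hi.2
    rw [RootLE] at hij h2 ⊢
    rw [← sub_add_sub_cancel _ (P.root i)]
    exact add_mem hij h2
  · -- The sum of two roots of the ideal has coefficient `2` at `a`.
    have h1 := hle k hk
    rw [← h, map_add, ((hΔ.mem_principalIdeal_iff he ha hle).1 hi).2,
      ((hΔ.mem_principalIdeal_iff he ha hle).1 hj).2] at h1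
    norm_num at h1

/-- In an irreducible subsystem, the ideal generated by a simple root `a` of multiplicity `1` is
maximal among the abelian ideals: a root of maximal height among the roots of a larger abelian ideal
in which `a` does not occur forms an obtuse angle with `a` itself, hence its sum with `a` is a root.
-/
lemma maximal_principalIdeal [Finite ι] [P.IsRootSystem] [P.IsCrystallographic] [P.IsReduced]
    (hΔ : IsSimpleSystem P Ψ Δ) (hΨ : IsSubsystem P Ψ) (hirr : IsIrreducibleSet P Δ)
    (he : IsDualFamily P.root Δ e) {a : ι} (ha : a ∈ Δ) (hle : ∀ i ∈ Ψ, e a (P.root i) ≤ 1) :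
    Maximal (IsAbelianIdeal P Ψ (posRoots P Ψ Δ)) (principalIdeal P (posRoots P Ψ Δ) a) := by
  classical
  have := Fintype.ofFinite ι
  refine ⟨hΔ.isAbelianIdeal_principalIdeal he ha hle, fun J hJ hIJ i hi => ?_⟩
  by_contra hiI
  have haJ : a ∈ J := hIJ ((hΔ.mem_principalIdeal_iff he ha hle).2
    ⟨hΔ.1 ha, he.apply_self a ha⟩)
  have hi0 : e a (P.root i) = 0 := by
    obtain ⟨n, hn⟩ := he.exists_nat ha (hJ.1 hi).2
    have h1 := hle i (hJ.1 hi).1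
    have h2 : e a (P.root i) ≠ 1 :=
      fun h => hiI ((hΔ.mem_principalIdeal_iff he ha hle).2 ⟨(hJ.1 hi).1, h⟩)
    rw [hn] at h1 h2 ⊢
    have h1' : n ≤ 1 := by exact_mod_cast h1
    have h2' : n ≠ 1 := by exact_mod_cast h2
    have : n = 0 := by lia
    simp [this]
  obtain ⟨β, ⟨hβ, hβ0⟩, hmax⟩ := Set.exists_max_image {j ∈ J | e a (P.root j) = 0}
    (fun j => ∑ δ with δ ∈ Δ, e δ (P.root j)) (Set.toFinite _) ⟨i, hi, hi0⟩
  obtain ⟨δ, hδ, hneg⟩ := hΔ.exists_pairing_neg hΨ hirr he (hJ.1 hβ) ha hβ0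
  have hβδ : β ≠ δ := by
    rintro rfl
    rw [P.pairing_same] at hneg
    norm_num at hneg
  obtain ⟨h1, h2⟩ := hΔ.rootLE_reflectionPerm hδ hneg
  have hpos := hΔ.reflectionPerm_mem_posRoots hΨ (hJ.1 hβ) hδ hβδ
  have hmem := hJ.2.1 β hβ _ hpos h1
  by_cases hδa : δ = a
  · subst hδa
    obtain ⟨k, hk⟩ := exists_int_pairing P β δ
    have hk1 : k = -1 := by
      have h3 := hle _ hpos.1
      rw [root_reflectionPerm_eq, map_sub, map_smul, hβ0, he.apply_self δ ha, hk, smul_eq_mul,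
        mul_one, zero_sub] at h3
      rw [hk] at hneg
      have h4 : -k ≤ 1 := by exact_mod_cast h3
      have h5 : k < 0 := by exact_mod_cast hneg
      lia
    refine hJ.2.2 β hβ δ haJ _ hpos.1 ?_
    rw [root_reflectionPerm_eq, hk, hk1]
    simp
  · refine (he.sum_lt_sum_of_sub_mem_closure ((rootLE_posRoots_iff P hΔ.1).1 h1) h2).not_ge
      (hmax _ ⟨hmem, ?_⟩)
    rw [root_reflectionPerm_eq, map_sub, map_smul, hβ0, he.apply_of_ne a ha δ hδ hδa]
    simp

end IsSimpleSystem
end Nilradical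

/-! ### The subsystem attached to a standard parabolic face -/

section Face

variable {P : RootPairing ι ℝ M N} {Δ S : Set ι} {e : ι → M →ₗ[ℝ] ℝ} {θ : ι}

lemma neg_mem_closure_image {J : Set ι} {x : M} (hx : x ∈ AddSubmonoid.closure (P.root '' J)) :
    -x ∈ AddSubmonoid.closure (P.root '' ((fun i => P.reflectionPerm i i) '' J)) := by
  induction hx using AddSubmonoid.closure_induction with
  | mem x hx =>
    obtain ⟨i, hi, rfl⟩ := hx
    exact AddSubmonoid.subset_closure ⟨_, Set.mem_image_of_mem _ hi, by simp⟩
  | zero => simp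
  | add x y _ _ hx hy =>
    rw [neg_add]
    exact add_mem hx hy

/-- The roots that are integral multiples of `θ` modulo the span of the simple roots outside `S`.
Here `e α x` stands for the coefficient of the simple root `α` in `x`. -/
def faceSubsystem (P : RootPairing ι ℝ M N) (e : ι → M →ₗ[ℝ] ℝ) (θ : ι) (S : Set ι) : Set ι :=
  {i | ∃ n : ℤ, ∀ α ∈ S, e α (P.root i) = n * e α (P.root θ)}

lemma isSubsystem_faceSubsystem [P.IsCrystallographic] :
    IsSubsystem P (faceSubsystem P e θ S) := by
  rintro i ⟨m, hm⟩ j ⟨n, hn⟩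
  obtain ⟨k, hk⟩ := exists_int_pairing P j i
  refine ⟨n - k * m, fun α hα => ?_⟩
  rw [root_reflectionPerm_eq, map_sub, map_smul, hm α hα, hn α hα, hk, smul_eq_mul]
  push_cast
  ring

lemma one_le_coeff_highestRoot (hΔ : IsSimpleSystem P Set.univ Δ) (he : IsDualFamily P.root Δ e)
    (hθ : IsHighestRoot P (posRoots P Set.univ Δ) θ) {α : ι} (hα : α ∈ Δ) :
    1 ≤ e α (P.root θ) := by
  have := he.nonneg hα ((rootLE_posRoots_iff P hΔ.1).1 (hθ.2 α (hΔ.subset_posRoots hα)))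
  rw [map_sub, he.apply_self α hα] at this
  linarith

lemma coeff_le_coeff_highestRoot (hΔ : IsSimpleSystem P Set.univ Δ) (he : IsDualFamily P.root Δ e)
    (hθ : IsHighestRoot P (posRoots P Set.univ Δ) θ) {α : ι} (hα : α ∈ Δ) (i : ι) :
    e α (P.root i) ≤ e α (P.root θ) := by
  rcases le_or_gt (e α (P.root i)) 0 with h | h
  · linarith [one_le_coeff_highestRoot hΔ he hθ hα]
  · have := he.nonneg hα ((rootLE_posRoots_iff P hΔ.1).1
      (hθ.2 i (hΔ.mem_posRoots he (Set.mem_univ i) hα h)))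
    rw [map_sub] at this
    linarith

variable (P) in
/-- The set consisting of `θ` and of the negatives of the roots in `J`. -/
def insertNeg (θ : ι) (J : Set ι) : Set ι :=
  {θ} ∪ (fun i => P.reflectionPerm i i) '' J

lemma apply_root_of_mem_neg (he : IsDualFamily P.root Δ e) (hS : S ⊆ Δ) {α i : ι} (hα : α ∈ S)
    (hi : i ∈ (fun i => P.reflectionPerm i i) '' (Δ \ S)) : e α (P.root i) = 0 := by
  obtain ⟨j, hj, rfl⟩ := hi
  have : j ≠ α := fun h => hj.2 (h ▸ hα)
  simp [he.apply_of_ne α (hS hα) j hj.1 this]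

lemma notMem_neg (hΔ : IsSimpleSystem P Set.univ Δ) (he : IsDualFamily P.root Δ e)
    (hθ : IsHighestRoot P (posRoots P Set.univ Δ) θ) (hS : S ⊆ Δ) (hne : S.Nonempty) :
    θ ∉ (fun i => P.reflectionPerm i i) '' (Δ \ S) := by
  obtain ⟨s, hs⟩ := hne
  intro h
  have h1 := one_le_coeff_highestRoot hΔ he hθ (hS hs)
  rw [apply_root_of_mem_neg he hS hs h] at h1
  norm_num at h1

/-- The coefficient of `θ` relative to `{θ} ∪ -(Δ \ S)` is read off from the coefficient at any
element of `S` relative to `Δ`. -/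
lemma coeff_eq_mul_coeff_highestRoot (hΔ : IsSimpleSystem P Set.univ Δ)
    (he : IsDualFamily P.root Δ e) (hθ : IsHighestRoot P (posRoots P Set.univ Δ) θ) (hS : S ⊆ Δ)
    {e' : ι → M →ₗ[ℝ] ℝ} (he' : IsDualFamily P.root (insertNeg P θ (Δ \ S)) e') {α : ι} (hα : α ∈ S)
    {x : M} (hx : x ∈ Submodule.span ℝ (P.root '' insertNeg P θ (Δ \ S))) :
    e α x = e' θ x * e α (P.root θ) := by
  induction hx using Submodule.span_induction with
  | mem x hx =>
    obtain ⟨i, hi, rfl⟩ := hx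
    rcases id hi with rfl | h
    · simp [he'.apply_self i hi]
    · have : i ≠ θ := fun h' => notMem_neg hΔ he hθ hS ⟨α, hα⟩ (h' ▸ h)
      rw [apply_root_of_mem_neg he hS hα h, he'.apply_of_ne θ (Or.inl rfl) i hi this, zero_mul]
  | zero => simp
  | add x y _ _ hx hy => rw [map_add, map_add, hx, hy, add_mul]
  | smul c x _ hx => rw [map_smul, map_smul, hx, smul_eq_mul, smul_eq_mul, mul_assoc]

lemma linearIndepOn_insertNeg (hΔ : IsSimpleSystem P Set.univ Δ)
    (he : IsDualFamily P.root Δ e) (hθ : IsHighestRoot P (posRoots P Set.univ Δ) θ) (hS : S ⊆ Δ)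
    (hne : S.Nonempty) : LinearIndepOn ℝ P.root (insertNeg P θ (Δ \ S)) := by
  rw [insertNeg, Set.singleton_union]
  refine LinearIndepOn.insert (LinearIndepOn.image_of_comp _ _ ?_) fun hmem => ?_
  · have h1 : P.root ∘ (fun i => P.reflectionPerm i i) = -P.root := by
      ext i
      simp
    rw [h1]
    have h2 := (hΔ.2.1.mono Set.sdiff_subset : LinearIndepOn ℝ P.root (Δ \ S))
    exact h2.linearIndependent.neg
  · obtain ⟨s, hs⟩ := hne
    have h1 : Submodule.span ℝ (P.root '' ((fun i => P.reflectionPerm i i) '' (Δ \ S))) ≤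
        LinearMap.ker (e s) := by
      rw [Submodule.span_le]
      rintro _ ⟨i, hi, rfl⟩
      exact apply_root_of_mem_neg he hS hs hi
    have h2 : e s (P.root θ) = 0 := h1 hmem
    have h3 := one_le_coeff_highestRoot hΔ he hθ (hS hs)
    rw [h2] at h3
    norm_num at h3

/-- The key point: a root of `faceSubsystem` is congruent to `θ`, `0` or `-θ` modulo the span of
`Δ \ S`, because its coefficient at an element of `S` is bounded by the one of `θ`. Accordingly it
is at most `θ`, or a combination of `Δ \ S` with coefficients of the same sign, or the negative of
a root that is at most `θ`. -/
lemma isSimpleSystem_insertNeg [Finite ι] (hΔ : IsSimpleSystem P Set.univ Δ)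
    (he : IsDualFamily P.root Δ e) (hθ : IsHighestRoot P (posRoots P Set.univ Δ) θ) (hS : S ⊆ Δ)
    (hne : S.Nonempty) :
    IsSimpleSystem P (faceSubsystem P e θ S) (insertNeg P θ (Δ \ S)) := by
  have := Fintype.ofFinite ι
  have hsub : AddSubmonoid.closure (P.root '' ((fun i => P.reflectionPerm i i) '' (Δ \ S))) ≤
      AddSubmonoid.closure (P.root '' insertNeg P θ (Δ \ S)) :=
    AddSubmonoid.closure_mono (Set.image_mono Set.subset_union_right)
  have hone : ∀ i, (∀ α ∈ S, e α (P.root i) = e α (P.root θ)) →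
      P.root i ∈ AddSubmonoid.closure (P.root '' insertNeg P θ (Δ \ S)) := by
    intro i hi
    obtain ⟨s, hs⟩ := hne
    have hpos : i ∈ posRoots P Set.univ Δ := hΔ.mem_posRoots he (Set.mem_univ i) (hS hs) (by
      rw [hi s hs]
      linarith [one_le_coeff_highestRoot hΔ he hθ (hS hs)])
    have h1 := (rootLE_posRoots_iff P hΔ.1).1 (hθ.2 i hpos)
    have h2 : P.root θ - P.root i ∈ AddSubmonoid.closure (P.root '' (Δ \ S)) := by
      refine he.mem_closure (closure_le_span Δ h1) (fun δ hδ => he.exists_nat hδ h1)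
        fun δ hδ hδS => ?_
      have hδS' : δ ∈ S := by
        by_contra h
        exact hδS ⟨hδ, h⟩
      rw [map_sub, hi δ hδS', sub_self]
    have h3 := add_mem (AddSubmonoid.subset_closure (s := P.root '' insertNeg P θ (Δ \ S))
      (Set.mem_image_of_mem _ (Or.inl rfl))) (hsub (neg_mem_closure_image h2))
    simpa using h3
  have hzero : ∀ i, (∀ α ∈ S, e α (P.root i) = 0) →
      P.root i ∈ AddSubmonoid.closure (P.root '' Δ) →
      -P.root i ∈ AddSubmonoid.closure (P.root '' insertNeg P θ (Δ \ S)) := by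
    intro i hi hpos
    refine hsub (neg_mem_closure_image (he.mem_closure (closure_le_span Δ hpos)
      (fun δ hδ => he.exists_nat hδ hpos) fun δ hδ hδS => hi δ ?_))
    by_contra h
    exact hδS ⟨hδ, h⟩
  refine ⟨?_, linearIndepOn_insertNeg hΔ he hθ hS hne, ?_⟩
  · rintro i (rfl | hi)
    · exact ⟨1, fun α _ => by simp⟩
    · exact ⟨0, fun α hα => by simp [apply_root_of_mem_neg he hS hα hi]⟩
  · rintro i ⟨n, hn⟩
    have hn1 : -1 ≤ n ∧ n ≤ 1 := by
      obtain ⟨s, hs⟩ := hne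
      have h0 := one_le_coeff_highestRoot hΔ he hθ (hS hs)
      have h1 := coeff_le_coeff_highestRoot hΔ he hθ (hS hs) i
      have h2 := coeff_le_coeff_highestRoot hΔ he hθ (hS hs) (P.reflectionPerm i i)
      rw [P.root_reflectionPerm, P.reflection_apply_self, map_neg] at h2
      rw [hn s hs] at h1 h2
      have h3 : (n : ℝ) ≤ 1 := by nlinarith
      have h4 : (-1 : ℝ) ≤ n := by nlinarith
      exact ⟨by exact_mod_cast h4, by exact_mod_cast h3⟩
    have hn2 : n = 1 ∨ n = 0 ∨ n = -1 := by lia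
    rcases hn2 with rfl | rfl | rfl
    · exact Or.inl (hone i fun α hα => by simpa using hn α hα)
    · have hn0 : ∀ α ∈ S, e α (P.root i) = 0 := fun α hα => by simpa using hn α hα
      rcases hΔ.2.2 i (Set.mem_univ i) with h | h
      · exact Or.inr (hzero i hn0 h)
      · refine Or.inl ?_
        have := hzero (P.reflectionPerm i i) (fun α hα => by simp [hn0 α hα]) (by simpa using h)
        simpa using this
    · refine Or.inr ?_
      have := hone (P.reflectionPerm i i) fun α hα => by simp [hn α hα]
      simpa using this

end Face

section Base

variable {P : RootPairing ι ℝ M N} (b : P.Base)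

lemma isSimpleSystem_base : IsSimpleSystem P Set.univ b.support :=
  ⟨Set.subset_univ _, b.linearIndepOn_root, fun i _ => b.root_mem_or_neg_mem i⟩

lemma opp_eq_insertNeg (θ : ι) (S : Set b.support) :
    opp b θ Sᶜ = insertNeg P θ ((b.support : Set ι) \ Subtype.val '' S) := by
  rw [opp, insertNeg]
  congr 1
  ext i
  constructor
  · rintro ⟨j, hj, rfl⟩
    exact ⟨j, ⟨j.2, by simpa using hj⟩, rfl⟩
  · rintro ⟨j, ⟨hj, hjS⟩, rfl⟩
    exact ⟨⟨j, hj⟩, fun h => hjS ⟨_, h, rfl⟩, rfl⟩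

variable [P.IsRootSystem]

lemma exists_isDualFamily_coord : ∃ e, IsDualFamily P.root (b.support : Set ι) e ∧
    ∀ α : b.support, e α = b.toWeightBasis.coord α := by
  classical
  refine ⟨fun i => if h : i ∈ b.support then b.toWeightBasis.coord ⟨i, h⟩ else 0, ⟨?_, ?_⟩, ?_⟩
  · intro i hi
    have hi' : i ∈ b.support := hi
    have := b.toWeightBasis_repr_root ⟨i, hi'⟩
    simp_all
  · intro i hi j hj hij
    have hi' : i ∈ b.support := hi
    have hj' : j ∈ b.support := hj
    have := b.toWeightBasis_repr_root ⟨j, hj'⟩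
    simp_all
  · intro α
    simp

lemma mem_faceIdeal_iff {e : ι → M →ₗ[ℝ] ℝ}
    (he : ∀ α : b.support, e α = b.toWeightBasis.coord α) (θ : ι) (S : Set b.support) (i : ι) :
    i ∈ faceIdeal b θ S ↔ ∀ α ∈ Subtype.val '' S, e α (P.root i) = e α (P.root θ) := by
  simp only [faceIdeal, parabolicFace, Set.mem_ofPred_eq, Set.mem_iInter, Set.mem_inter_iff]
  constructor
  · rintro h _ ⟨α, hα, rfl⟩
    rw [he]
    exact (h α hα).1
  · intro h α hα
    refine ⟨?_, subset_convexHull ℝ _ (Set.mem_range_self i)⟩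
    rw [← he]
    exact h α ⟨α, hα, rfl⟩

end Base

end RootFaces

end

open RootFaces in
theorem mainTheorem10 {ι M N : Type*} [Finite ι]
    [AddCommGroup M] [Module ℝ M] [AddCommGroup N] [Module ℝ N]
    (P : RootPairing ι ℝ M N) [P.IsRootSystem] [P.IsCrystallographic] [P.IsReduced]
    [P.IsIrreducible] (b : P.Base)
    (θ : ι) (hθ : IsHighestRoot P (posRoots P Set.univ b.support) θ)
    (S : Set b.support) (hS : S.Nonempty) :
    -- the irreducible component of `θ`
    (IsIrreducibleComponent P (generated P (oppTheta b θ Sᶜ)) (generated P (opp b θ Sᶜ)) ∧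
      IsSimpleSystem P (generated P (oppTheta b θ Sᶜ)) (oppTheta b θ Sᶜ) ∧
      IsAbelianNilradical P (generated P (oppTheta b θ Sᶜ)) (oppTheta b θ Sᶜ)
        (faceIdeal b θ S) ∧
      faceIdeal b θ S = principalIdeal P
        (posRoots P (generated P (oppTheta b θ Sᶜ)) (oppTheta b θ Sᶜ)) θ ∧
      HasMultiplicity P (generated P (oppTheta b θ Sᶜ)) (oppTheta b θ Sᶜ) θ 1) ∧
    -- the whole subsystem generated by `(Π ∖ S)°`, which may be reducible
    (IsSimpleSystem P (generated P (opp b θ Sᶜ)) (opp b θ Sᶜ) ∧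
      faceIdeal b θ S = principalIdeal P
        (posRoots P (generated P (opp b θ Sᶜ)) (opp b θ Sᶜ)) θ ∧
      IsGreatest {c : ℝ | ∃ i ∈ generated P (opp b θ Sᶜ),
        HasCoeff P (opp b θ Sᶜ) θ (P.root i) c} 1) := by
  obtain ⟨e, he, hcoord⟩ := exists_isDualFamily_coord b
  have hΔ := isSimpleSystem_base b
  have hSΔ : Subtype.val '' S ⊆ (b.support : Set ι) := by
    rintro _ ⟨α, -, rfl⟩
    exact α.2
  have hSne : (Subtype.val '' S).Nonempty := hS.image _
  have hface := mem_faceIdeal_iff b hcoord θ S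
  rw [oppTheta, opp_eq_insertNeg]
  generalize faceIdeal b θ S = I at hface ⊢
  generalize Subtype.val '' S = S' at hSΔ hSne hface ⊢
  have hA := isSimpleSystem_insertNeg hΔ he hθ hSΔ hSne
  have hgen := hA.generated_eq isSubsystem_faceSubsystem
  have hcoeff := fun e' he' α hα x hx =>
    coeff_eq_mul_coeff_highestRoot hΔ he hθ hSΔ (e' := e') he' (α := α) hα (x := x) hx
  have hone := fun α hα => one_le_coeff_highestRoot hΔ he hθ (α := α) (hSΔ hα)
  have hmax := fun α hα i => coeff_le_coeff_highestRoot hΔ he hθ (α := α) (hSΔ hα) i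
  have hIΨ : I ⊆ faceSubsystem P e θ S' :=
    fun i hi => ⟨1, fun α hα => by simp [(hface i).1 hi α hα]⟩
  have hθA : θ ∈ insertNeg P θ ((b.support : Set ι) \ S') := Or.inl rfl
  rw [← hgen] at hA hIΨ
  generalize insertNeg P θ ((b.support : Set ι) \ S') = A at *
  obtain ⟨e', he'⟩ := exists_isDualFamily hA.2.1
  obtain ⟨s, hs⟩ := hSne
  have hle : ∀ i ∈ generated P A, e' θ (P.root i) ≤ 1 := by
    intro i hi
    have h1 := hcoeff e' he' s hs _ (hA.root_mem_span hi)
    have h2 := hmax s hs i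
    rw [h1] at h2
    nlinarith [hone s hs]
  -- On the subsystem, the face ideal is where `θ` has coefficient `1`.
  have hI : ∀ i, i ∈ I ↔ i ∈ generated P A ∧ e' θ (P.root i) = 1 := by
    intro i
    refine ⟨fun hi => ⟨hIΨ hi, ?_⟩, fun ⟨hi, h1⟩ => (hface i).2 fun α hα => ?_⟩
    · have h1 := hcoeff e' he' s hs _ (hA.root_mem_span (hIΨ hi))
      rw [(hface i).1 hi s hs] at h1
      exact (mul_eq_right₀ (by linarith [hone s hs])).1 h1.symm
    · rw [hcoeff e' he' α hα _ (hA.root_mem_span hi), h1, one_mul]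
  have hC := connectedPart_subset P hθA
  have hsys := isSubsystem_generated P (A := connectedPart P A θ)
  have hCΔ := hA.generated_of_subset (isSubsystem_generated P) hC
  have hCirr := isIrreducibleSet_connectedPart P (A := A) (a := θ)
  have hθC := mem_connectedPart P (A := A) (a := θ)
  have heC := he'.mono hC
  have hleC : ∀ i ∈ generated P (connectedPart P A θ), e' θ (P.root i) ≤ 1 :=
    fun i hi => hle i (generated_mono P hC hi)
  -- In the roots of the other components, `θ` does not occur.
  have hIC : I = principalIdeal P
      (posRoots P (generated P (connectedPart P A θ)) (connectedPart P A θ)) θ := by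
    ext i
    rw [hI, hCΔ.mem_principalIdeal_iff heC hθC hleC]
    refine ⟨fun ⟨hi, h1⟩ => ⟨?_, h1⟩, fun ⟨hi, h1⟩ => ⟨generated_mono P hC hi, h1⟩⟩
    rw [← Set.union_sdiff_cancel hC] at hi
    refine (generated_union_subset P (isOrthogonal_of_notMem_connectedPart P hθA) hi).resolve_right
      fun h => ?_
    rw [he'.apply_eq_zero_of_mem_span Set.sdiff_subset hθA (fun h => h.2 hθC)
      (root_mem_span_of_mem_generated P h)] at h1
    norm_num at h1
  have hmult := hCΔ.hasMultiplicity_one hsys hCirr heC hθC hleC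
  refine ⟨⟨isIrreducibleComponent_connectedPart P hθA, hCΔ, Or.inr ⟨?_, θ, hθC, hmult, hIC⟩, hIC,
    hmult⟩, hA, ?_, ⟨θ, subset_generated P hθA, ?_⟩, ?_⟩
  · rw [hIC]
    exact hCΔ.maximal_principalIdeal hsys hCirr heC hθC hleC
  · ext i
    rw [hI, hA.mem_principalIdeal_iff he' hθA hle]
  · simpa [he'.apply_self θ hθA] using
      he'.hasCoeff hθA (hA.root_mem_span (subset_generated P hθA))
  · rintro c ⟨i, hi, hc⟩
    rw [← he'.apply_eq_of_hasCoeff hθA hc]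
    exact hle i hi
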